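/- Let $1\le d\le n$. A $k$-cube in $\{0,1\}^n$ is a set obtained by fixing $n-k$ of the coordinates to given values and leaving the other $k$ coordinates (its directions) free. A collection $\mathcal C$ of $\binom nd$ subcubes of $\{0,1\}^n$ is $d$-complete if for every $I\subseteq[n]$ with $|I|=d$ it contains a $d$-cube whose projection onto the coordinates $I$ is all of $\{0,1\}^I$. The VC dimension of $C\subseteq\{0,1\}^n$ is the largest $|I|$, $I\subseteq[n]$, such that $C$ projects onto $\{0,1\}^I$; a class $C$ of VC dimension $d$ is maximum if $|C|=\sum_{i=0}^{d}\binom ni$. For a $d$-complete collection $\mathcal C$ and a set $S\subseteq[n]$ with $|S|=d-1$, the $(d-1)$-iterated reduction along $S$ is the graph whose edges are the images, under the projection $\{0,1\}^n\to\{0,1\}^{[n]\setminus S}$, of the $n-d+1$ $d$-cubes of $\mathcal C$ whose directions include $S$, whose nodes are the images of the $(d-1)$-faces of these cubes with set of directions $S$, and in which a node is incident to an edge when the former comes from a face of the cube that gives the latter. Theorem. Let $C$ be the union of the cubes of a $d$-complete collection $\mathcal C$ in $\{0,1\}^n$. Then every $(d-1)$-iterated reduction of $\mathcal C$ is a forest,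 and $C$ is a maximum class of VC dimension $d$ if and only if all the $(d-1)$-iterated reductions of $\mathcal C$ are trees, equivalently, if and only if all of them are connected. -/

import Mathlib

namespace ConceptClass

/-- The projection `p_I(C) = {(c_i)_{i ∈ I} | c ∈ C}` of a set `C` of points of the binary `n`-cube
onto the coordinates in `I`. -/
def proj {n : ℕ} (I : Finset (Fin n)) (C : Finset (Fin n → Bool)) : Finset (I → Bool) :=
  C.image fun c i => c i

/-- The VC dimension: the largest size of a set `I` of coordinates with `p_I(C) = {0,1}^I`. -/
def vcDim {n : ℕ} (C : Finset (Fin n → Bool)) : ℕ :=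
  ((Finset.univ : Finset (Finset (Fin n))).filter fun I => proj I C = Finset.univ).sup Finset.card

/-- A class is maximum if it meets Sauer's bound `|C| ≤ ∑_{i ≤ VC(C)} (n choose i)` with equality. -/
def IsMaximum {n : ℕ} (C : Finset (Fin n → Bool)) : Prop :=
  C.card = ∑ i ∈ Finset.range (vcDim C + 1), n.choose i

/-- `Q` is a subcube whose set of directions (free coordinates) is exactly `D`; the coordinates
outside `D` are fixed to the values of some `a`. -/
def IsCubeAlong {n : ℕ} (D : Finset (Fin n)) (Q : Finset (Fin n → Bool)) : Prop :=
  ∃ a : Fin n → Bool, ∀ x, x ∈ Q ↔ ∀ i, i ∉ D → x i = a i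

/-- `Q` is a `k`-dimensional subcube of the binary `n`-cube. -/
def IsCube {n : ℕ} (k : ℕ) (Q : Finset (Fin n → Bool)) : Prop :=
  ∃ D : Finset (Fin n), D.card = k ∧ IsCubeAlong D Q

/-- A `d`-complete collection: `n choose d` subcubes such that for every set `I` of `d` coordinates
some `d`-cube of the collection projects onto `{0,1}^I`. -/
structure IsComplete {n : ℕ} (d : ℕ) (𝒞 : Finset (Finset (Fin n → Bool))) : Prop where
  subcube : ∀ Q ∈ 𝒞, ∃ k, IsCube k Q
  card_eq : 𝒞.card = n.choose d
  exists_cube : ∀ I : Finset (Fin n), I.card = d → ∃ Q ∈ 𝒞, IsCube d Q ∧ proj I Q = Finset.univ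

/-- The concept class formed by all points of the cubes of a collection. -/
def union {n : ℕ} (𝒞 : Finset (Finset (Fin n → Bool))) : Finset (Fin n → Bool) :=
  𝒞.biUnion id

/-- `Q` is a cube of the collection that varies along `S` and exactly one further direction. -/
def IsEdgeCube {n : ℕ} (𝒞 : Finset (Finset (Fin n → Bool))) (S : Finset (Fin n))
    (Q : Finset (Fin n → Bool)) : Prop :=
  Q ∈ 𝒞 ∧ ∃ i, i ∉ S ∧ IsCubeAlong (insert i S) Q

/-- The point `v` of the cube `{0,1}^{Sᶜ}` is the image of a face of `Q` whose set of directions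
is `S`. -/
def Incident {n : ℕ} (S : Finset (Fin n)) (v : (Sᶜ : Finset (Fin n)) → Bool)
    (Q : Finset (Fin n → Bool)) : Prop :=
  ∃ F : Finset (Fin n → Bool), IsCubeAlong S F ∧ F ⊆ Q ∧ proj Sᶜ F = {v}

/-- The nodes of the iterated reduction along `S`. -/
def ReductionNode {n : ℕ} (𝒞 : Finset (Finset (Fin n → Bool))) (S : Finset (Fin n)) : Type :=
  {v : (Sᶜ : Finset (Fin n)) → Bool // ∃ Q, IsEdgeCube 𝒞 S Q ∧ Incident S v Q}

/-- The iterated reduction of the collection along `S`: two distinct nodes are joined by an edge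
when they are incident to a common cube. Every such cube projects to an edge of `{0,1}^{Sᶜ}`, and
different cubes of a complete collection project to edges of different directions, so there
are no multiple edges. -/
def iteratedReduction {n : ℕ} (𝒞 : Finset (Finset (Fin n → Bool))) (S : Finset (Fin n)) :
    SimpleGraph (ReductionNode 𝒞 S) where
  Adj v w := v ≠ w ∧ ∃ Q, IsEdgeCube 𝒞 S Q ∧ Incident S v.1 Q ∧ Incident S w.1 Q
  symm := ⟨fun _ _ ⟨h, Q, hQ, hv, hw⟩ => ⟨h.symm, Q, hQ, hw, hv⟩⟩
  loopless := ⟨fun _ h => h.1 rfl⟩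

end ConceptClass

/-! Since the number of cubes is `n.choose d`, a complete collection has exactly one cube `cube I (a
I)` per `d`-set `I`. Hence a reduction has exactly one edge per direction outside `S`. Deleting the
edge of direction `i` freezes coordinate `i` along every path, so each edge is a bridge: the
reduction is a forest.

If the union has VC dimension `d`, the node set has VC dimension at most 1, so Sauer gives at most
`n - |S| + 1` nodes against `n - |S|` edges, and the forest is a tree.

Conversely, connectedness lets a cube's directions be exchanged one by one for directions in a given
`K`, keeping a point's trace on `K` (`exists_cube_within`). For `|K| = d + 1` only `d + 1` cubes
then matter, and one pattern avoids them all; so Sauer bounds the union above. Containing a cube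
along every `d`-set bounds it below (`sum_choose_le_card`). -/

namespace ConceptClass

open Finset

/-! ### Shattering and the two bounds on the size of a class -/

section Shattering

variable {ι : Type*}

/-- Every pattern on the coordinates in `I` is realised by a point of `C`. -/
def Realizes (C : Finset (ι → Bool)) (I : Finset ι) : Prop :=
  ∀ t : ι → Bool, ∃ c ∈ C, ∀ i ∈ I, c i = t i

lemma not_realizes_of_succ {C : Finset (ι → Bool)} {d : ℕ}
    (h : ∀ I : Finset ι, I.card = d + 1 → ¬ Realizes C I) (I : Finset ι) (hI : Realizes C I) :
    I.card ≤ d := by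
  by_contra hlt
  obtain ⟨J, hJI, hJ⟩ := exists_subset_card_eq (show d + 1 ≤ I.card by omega)
  exact h J hJ fun t => (hI t).imp fun c hc => ⟨hc.1, fun i hi => hc.2 i (hJI hi)⟩

lemma support_injective [Fintype ι] :
    Function.Injective fun c : ι → Bool => univ.filter fun i => c i = true := by
  intro c c' h
  funext i
  have := congrArg (i ∈ ·) h
  simp only [mem_filter, mem_univ, true_and, eq_iff_iff] at this
  exact Bool.eq_iff_iff.2 this

variable [Fintype ι] [DecidableEq ι]

/-- The supports of the points of `C`. -/
def supports (C : Finset (ι → Bool)) : Finset (Finset ι) :=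
  C.image fun c => univ.filter fun i => c i = true

lemma card_supports (C : Finset (ι → Bool)) : (supports C).card = C.card :=
  card_image_of_injective _ support_injective

lemma shatters_supports_iff (C : Finset (ι → Bool)) (I : Finset ι) :
    (supports C).Shatters I ↔ Realizes C I := by
  constructor
  · intro h t
    obtain ⟨u, hu, hI⟩ := h (filter_subset (fun i => t i = true) I)
    obtain ⟨c, hc, rfl⟩ := mem_image.1 hu
    refine ⟨c, hc, fun i hi => ?_⟩
    have := congrArg (i ∈ ·) hI
    simp only [mem_inter, hi, mem_filter, mem_univ, true_and, eq_iff_iff] at this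
    exact Bool.eq_iff_iff.2 this
  · intro h s hs
    obtain ⟨c, hc, hI⟩ := h fun i => decide (i ∈ s)
    refine ⟨_, mem_image_of_mem _ hc, ?_⟩
    ext i
    simp only [mem_inter, mem_filter, mem_univ, true_and]
    constructor
    · rintro ⟨hi, hci⟩
      simpa [hI i hi] using hci
    · intro hi
      exact ⟨hs hi, by simpa [hI i (hs hi)] using hi⟩

/-- Sauer's bound. -/
lemma card_le_sum_choose {C : Finset (ι → Bool)} {d : ℕ}
    (h : ∀ I, Realizes C I → I.card ≤ d) :
    C.card ≤ ∑ i ∈ range (d + 1), (Fintype.card ι).choose i := by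
  have hv : (supports C).vcDim ≤ d :=
    Finset.sup_le fun I hI => h I ((shatters_supports_iff C I).1 (mem_shatterer.1 hI))
  calc C.card = (supports C).card := (card_supports C).symm
    _ ≤ _ := card_le_card_shatterer _
    _ ≤ _ := card_shatterer_le_sum_vcDim
    _ ≤ _ := sum_le_sum_of_subset fun i hi =>
      mem_range.2 (Nat.lt_succ_of_le ((mem_Iic.1 hi).trans hv))

/-- The number of sets of directions of subcubes contained in a class is at most the size of the
class. -/
lemma sum_choose_le_card {C : Finset (ι → Bool)} {d : ℕ}
    (h : ∀ I : Finset ι, I.card ≤ d →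
      ∃ a : ι → Bool, ∀ x : ι → Bool, (∀ i, i ∉ I → x i = a i) → x ∈ C) :
    ∑ i ∈ range (d + 1), (Fintype.card ι).choose i ≤ C.card := by
  let L : Finset (Finset ι) := univ.filter fun I => I.card ≤ d
  have hL : L.card = ∑ i ∈ range (d + 1), (Fintype.card ι).choose i := by
    rw [card_eq_sum_card_fiberwise (f := Finset.card) (t := range (d + 1))]
    · refine sum_congr rfl fun i hi => ?_
      rw [← card_univ, ← card_powersetCard]
      congr 1
      ext I
      have := mem_range.1 hi
      simp only [L, mem_filter, mem_univ, true_and, mem_powersetCard, subset_univ]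
      omega
    · intro I hI
      simpa [L, Nat.lt_succ_iff] using hI
  -- If `Cᶜ` shattered the complement of `I`, it would meet the cube along `I` contained in `C`.
  -- Pajor's inequality for `Cᶜ` then bounds `C` from below.
  have hsub : (supports Cᶜ).shatterer ⊆ univ \ L.image compl := by
    intro J hJ
    rw [mem_shatterer, shatters_supports_iff] at hJ
    simp only [mem_sdiff, mem_univ, true_and, mem_image, not_exists, not_and]
    rintro I hI rfl
    obtain ⟨a, ha⟩ := h I (by simpa [L] using hI)
    obtain ⟨c, hc, hca⟩ := hJ a
    exact mem_compl.1 hc (ha c fun i hi => hca i (mem_compl.2 hi))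
  have h1 := (card_le_card_shatterer (supports Cᶜ)).trans (card_le_card hsub)
  rw [card_supports, card_sdiff_of_subset (subset_univ _),
    card_image_of_injective _ compl_injective, card_compl, hL, card_univ] at h1
  have h2 : Fintype.card (ι → Bool) = Fintype.card (Finset ι) := by simp
  have h3 := card_le_univ C
  have h4 := card_le_univ L
  omega

end Shattering

/-! ### Subcubes and their directions -/

variable {n : ℕ}

lemma proj_eq_univ_iff (I : Finset (Fin n)) (C : Finset (Fin n → Bool)) :
    proj I C = univ ↔ Realizes C I := by
  simp only [proj, eq_univ_iff_forall, mem_image]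
  constructor
  · intro h t
    obtain ⟨c, hc, hI⟩ := h fun i => t i
    exact ⟨c, hc, fun i hi => congrFun hI ⟨i, hi⟩⟩
  · intro h t
    obtain ⟨c, hc, hI⟩ := h fun i => if hi : i ∈ I then t ⟨i, hi⟩ else false
    exact ⟨c, hc, funext fun i => by simpa using hI i i.2⟩

lemma le_vcDim {C : Finset (Fin n → Bool)} {I : Finset (Fin n)} (h : Realizes C I) :
    I.card ≤ vcDim C :=
  Finset.le_sup (f := Finset.card) (by simpa [proj_eq_univ_iff] using h)

lemma vcDim_le {C : Finset (Fin n → Bool)} {d : ℕ} (h : ∀ I, Realizes C I → I.card ≤ d) :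
    vcDim C ≤ d :=
  Finset.sup_le fun I hI => h I ((proj_eq_univ_iff I C).1 (mem_filter.1 hI).2)

/-- The subcube through `a` with set of directions `D`. -/
def cube (D : Finset (Fin n)) (a : Fin n → Bool) : Finset (Fin n → Bool) :=
  univ.filter fun x => ∀ i, i ∉ D → x i = a i

lemma mem_cube {D : Finset (Fin n)} {a x : Fin n → Bool} :
    x ∈ cube D a ↔ ∀ i, i ∉ D → x i = a i := by
  simp [cube]

lemma isCubeAlong_cube (D : Finset (Fin n)) (a : Fin n → Bool) : IsCubeAlong D (cube D a) :=
  ⟨a, fun _ => mem_cube⟩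

lemma IsCubeAlong.exists_eq_cube {D : Finset (Fin n)} {Q : Finset (Fin n → Bool)}
    (h : IsCubeAlong D Q) : ∃ a, Q = cube D a :=
  h.imp fun _ ha => Finset.ext fun x => (ha x).trans mem_cube.symm

lemma subset_of_realizes_cube {I D : Finset (Fin n)} {a : Fin n → Bool}
    (h : Realizes (cube D a) I) : I ⊆ D := by
  intro i hi
  by_contra hD
  obtain ⟨c, hc, hct⟩ := h fun j => !(a j)
  have h1 := hct i hi
  rw [mem_cube.1 hc i hD] at h1
  simp at h1

lemma realizes_cube (D : Finset (Fin n)) (a : Fin n → Bool) : Realizes (cube D a) D :=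
  fun t => ⟨fun i => if i ∈ D then t i else a i, mem_cube.2 fun i hi => by simp [hi],
    fun i hi => by simp [hi]⟩

lemma directions_unique {D E : Finset (Fin n)} {a b : Fin n → Bool} (h : cube D a = cube E b) :
    D = E :=
  (subset_of_realizes_cube (h ▸ realizes_cube D a)).antisymm
    (subset_of_realizes_cube (h ▸ realizes_cube E b))

/-- A complete collection consists of exactly one cube along each set of `d` directions. -/
lemma IsComplete.exists_anchor {d : ℕ} {𝒞 : Finset (Finset (Fin n → Bool))}
    (h : IsComplete d 𝒞) :
    ∃ a : Finset (Fin n) → Fin n → Bool,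
      ∀ Q, Q ∈ 𝒞 ↔ ∃ I : Finset (Fin n), I.card = d ∧ Q = cube I (a I) := by
  have key : ∀ I : Finset (Fin n), ∃ a : Fin n → Bool, I.card = d → cube I a ∈ 𝒞 := by
    intro I
    by_cases hI : I.card = d
    · obtain ⟨Q, hQ, ⟨D, hD, hDQ⟩, hp⟩ := h.exists_cube I hI
      obtain ⟨a, rfl⟩ := hDQ.exists_eq_cube
      have hID : I = D := eq_of_subset_of_card_le
        (subset_of_realizes_cube ((proj_eq_univ_iff _ _).1 hp)) (by omega)
      exact ⟨a, fun _ => hID ▸ hQ⟩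
    · exact ⟨fun _ => false, fun h => absurd h hI⟩
  choose a ha using key
  -- The chosen cubes are distinct and already number `n.choose d`, leaving room for no others.
  have himg : (powersetCard d univ).image (fun I => cube I (a I)) = 𝒞 := by
    refine eq_of_subset_of_card_le ?_ ?_
    · intro Q hQ
      obtain ⟨I, hI, rfl⟩ := mem_image.1 hQ
      exact ha I (mem_powersetCard.1 hI).2
    · rw [card_image_of_injective _ fun I J hIJ => directions_unique hIJ, card_powersetCard,
        h.card_eq]
      simp
  refine ⟨a, fun Q => ?_⟩
  rw [← himg]
  simp [mem_powersetCard, eq_comm]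

lemma incident_cube_iff {S : Finset (Fin n)} {v : (Sᶜ : Finset (Fin n)) → Bool} {i : Fin n}
    {b : Fin n → Bool} :
    Incident S v (cube (insert i S) b) ↔
      ∀ j : (Sᶜ : Finset (Fin n)), (j : Fin n) ≠ i → v j = b j := by
  constructor
  · rintro ⟨F, -, hFQ, hv⟩ j hj
    have hvF : v ∈ proj Sᶜ F := by simp [hv]
    obtain ⟨x, hx, rfl⟩ := mem_image.1 hvF
    exact mem_cube.1 (hFQ hx) j (by simpa [hj] using mem_compl.1 j.2)
  · intro h
    let a : Fin n → Bool := fun j => if hj : j ∈ Sᶜ then v ⟨j, hj⟩ else false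
    have ha : ∀ j : (Sᶜ : Finset (Fin n)), a j = v j := fun j => by
      have := j.2
      simp only [a, dif_pos this]
    refine ⟨cube S a, isCubeAlong_cube S a, fun x hx => mem_cube.2 fun j hj => ?_, ?_⟩
    · rw [mem_insert, not_or] at hj
      rw [mem_cube.1 hx j hj.2, ha ⟨j, mem_compl.2 hj.2⟩]
      exact h ⟨j, mem_compl.2 hj.2⟩ hj.1
    · ext w
      simp only [proj, mem_image, mem_singleton]
      constructor
      · rintro ⟨x, hx, rfl⟩
        funext j
        exact (mem_cube.1 hx j (mem_compl.1 j.2)).trans (ha j)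
      · rintro rfl
        exact ⟨a, mem_cube.2 fun _ _ => rfl, funext ha⟩

/-! ### Edges of a reduction, and acyclicity -/

section Reduction

variable {d : ℕ} {𝒞 : Finset (Finset (Fin n → Bool))} {a : Finset (Fin n) → Fin n → Bool}
  {S : Finset (Fin n)}

lemma isEdgeCube_iff (ha : ∀ Q, Q ∈ 𝒞 ↔ ∃ I : Finset (Fin n), I.card = d ∧ Q = cube I (a I))
    (hS : S.card + 1 = d) {Q : Finset (Fin n → Bool)} :
    IsEdgeCube 𝒞 S Q ↔ ∃ i, i ∉ S ∧ Q = cube (insert i S) (a (insert i S)) := by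
  constructor
  · rintro ⟨hQ, i, hi, hQi⟩
    obtain ⟨I, -, rfl⟩ := (ha Q).1 hQ
    obtain ⟨b, hb⟩ := hQi.exists_eq_cube
    obtain rfl := directions_unique hb
    exact ⟨i, hi, rfl⟩
  · rintro ⟨i, hi, rfl⟩
    exact ⟨(ha _).2 ⟨_, by rw [card_insert_of_notMem hi, hS], rfl⟩, i, hi, isCubeAlong_cube _ _⟩

/-- The node `v` lies on the edge of direction `i` of the reduction along `S`. -/
def OnEdge (a : Finset (Fin n) → Fin n → Bool) (S : Finset (Fin n))
    (v : (Sᶜ : Finset (Fin n)) → Bool) (i : Fin n) : Prop :=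
  ∀ j : (Sᶜ : Finset (Fin n)), (j : Fin n) ≠ i → v j = a (insert i S) j

lemma isNode_iff (ha : ∀ Q, Q ∈ 𝒞 ↔ ∃ I : Finset (Fin n), I.card = d ∧ Q = cube I (a I))
    (hS : S.card + 1 = d) {v : (Sᶜ : Finset (Fin n)) → Bool} :
    (∃ Q, IsEdgeCube 𝒞 S Q ∧ Incident S v Q) ↔ ∃ i, i ∉ S ∧ OnEdge a S v i := by
  constructor
  · rintro ⟨Q, hQ, hv⟩
    obtain ⟨i, hi, rfl⟩ := (isEdgeCube_iff ha hS).1 hQ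
    exact ⟨i, hi, incident_cube_iff.1 hv⟩
  · rintro ⟨i, hi, hv⟩
    exact ⟨_, (isEdgeCube_iff ha hS).2 ⟨i, hi, rfl⟩, incident_cube_iff.2 hv⟩

lemma adj_iff (ha : ∀ Q, Q ∈ 𝒞 ↔ ∃ I : Finset (Fin n), I.card = d ∧ Q = cube I (a I))
    (hS : S.card + 1 = d) {v w : ReductionNode 𝒞 S} :
    (iteratedReduction 𝒞 S).Adj v w ↔
      v ≠ w ∧ ∃ i, i ∉ S ∧ OnEdge a S v.1 i ∧ OnEdge a S w.1 i := by
  constructor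
  · rintro ⟨hne, Q, hQ, hv, hw⟩
    obtain ⟨i, hi, rfl⟩ := (isEdgeCube_iff ha hS).1 hQ
    exact ⟨hne, i, hi, incident_cube_iff.1 hv, incident_cube_iff.1 hw⟩
  · rintro ⟨hne, i, hi, hv, hw⟩
    exact ⟨hne, _, (isEdgeCube_iff ha hS).2 ⟨i, hi, rfl⟩, incident_cube_iff.2 hv,
      incident_cube_iff.2 hw⟩

lemma OnEdge.eq_of_eq {v w : (Sᶜ : Finset (Fin n)) → Bool} {i : Fin n} (hi : i ∈ Sᶜ)
    (hv : OnEdge a S v i) (hw : OnEdge a S w i) (h : v ⟨i, hi⟩ = w ⟨i, hi⟩) : v = w := by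
  funext j
  by_cases hj : (j : Fin n) = i
  · obtain ⟨j, hj'⟩ := j
    subst hj
    exact h
  · rw [hv j hj, hw j hj]

lemma reachable_invariant {V α : Type*} {G : SimpleGraph V} {f : V → α}
    (h : ∀ v w, G.Adj v w → f v = f w) {v w : V} (hvw : G.Reachable v w) : f v = f w := by
  obtain ⟨p⟩ := hvw
  induction p with
  | nil => rfl
  | cons hadj _ ih => exact (h _ _ hadj).trans ih

lemma eq_of_ne_of_ne {p q r : Bool} (hq : p ≠ q) (hr : p ≠ r) : q = r := by
  revert p q r
  decide

theorem iteratedReduction_isAcyclic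
    (ha : ∀ Q, Q ∈ 𝒞 ↔ ∃ I : Finset (Fin n), I.card = d ∧ Q = cube I (a I))
    (hS : S.card + 1 = d) : (iteratedReduction 𝒞 S).IsAcyclic := by
  rw [SimpleGraph.isAcyclic_iff_forall_adj_isBridge]
  intro v w hvw
  rw [SimpleGraph.isBridge_iff]
  obtain ⟨hne, i, hi, hv, hw⟩ := (adj_iff ha hS).1 hvw
  have hi' : i ∈ Sᶜ := mem_compl.2 hi
  intro hr
  refine hne (Subtype.ext (hv.eq_of_eq hi' hw ?_))
  refine reachable_invariant (f := fun u : ReductionNode 𝒞 S => u.1 ⟨i, hi'⟩) ?_ hr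
  intro x y hxy
  rw [SimpleGraph.deleteEdges_adj] at hxy
  obtain ⟨hxy, hdel⟩ := hxy
  obtain ⟨hxyne, j, hj, hx, hy⟩ := (adj_iff ha hS).1 hxy
  by_cases hij : i = j
  · subst hij
    -- An edge of direction `i` on which coordinate `i` changes has ends `v` and `w`, so it is the
    -- deleted one.
    by_contra hval
    have hvwi : v.1 ⟨i, hi'⟩ ≠ w.1 ⟨i, hi'⟩ := fun h => hne (Subtype.ext (hv.eq_of_eq hi' hw h))
    apply hdel
    rw [Set.mem_singleton_iff, Sym2.eq_iff]
    by_cases hxv : x.1 ⟨i, hi'⟩ = v.1 ⟨i, hi'⟩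
    · exact Or.inl ⟨Subtype.ext (hx.eq_of_eq hi' hv hxv),
        Subtype.ext (hy.eq_of_eq hi' hw (eq_of_ne_of_ne hval (hxv ▸ hvwi)))⟩
    · have hxw := eq_of_ne_of_ne (Ne.symm hxv) hvwi
      exact Or.inr ⟨Subtype.ext (hx.eq_of_eq hi' hw hxw),
        Subtype.ext (hy.eq_of_eq hi' hv (eq_of_ne_of_ne hval hxv))⟩
  · exact (hx ⟨i, hi'⟩ hij).trans (hy ⟨i, hi'⟩ hij).symm

/-! ### Connected reductions bound the VC dimension -/

/-- The end of the edge of direction `i` whose `i`-th coordinate is `b`. -/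
def edgeEnd (a : Finset (Fin n) → Fin n → Bool) (S : Finset (Fin n)) (i : Fin n) (b : Bool) :
    (Sᶜ : Finset (Fin n)) → Bool :=
  fun j => if (j : Fin n) = i then b else a (insert i S) j

lemma onEdge_edgeEnd (i : Fin n) (b : Bool) : OnEdge a S (edgeEnd a S i b) i :=
  fun j hj => by simp [edgeEnd, hj]

/-- In a connected reduction, edges of directions outside `K` lead from any node to an edge of
direction in `K`. -/
lemma exists_onEdge_of_connected
    (ha : ∀ Q, Q ∈ 𝒞 ↔ ∃ I : Finset (Fin n), I.card = d ∧ Q = cube I (a I))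
    (hS : S.card + 1 = d) (hconn : (iteratedReduction 𝒞 S).Connected) {K : Finset (Fin n)}
    {k : Fin n} (hkK : k ∈ K) (hkS : k ∉ S) (v : ReductionNode 𝒞 S) :
    ∃ w : (Sᶜ : Finset (Fin n)) → Bool, ∃ i ∈ K, i ∉ S ∧ OnEdge a S w i ∧
      ∀ j : (Sᶜ : Finset (Fin n)), (j : Fin n) ∈ K → w j = v.1 j := by
  by_contra! hcon
  -- If no node agreeing with `v` on `K` met an edge of direction in `K`, this agreement would
  -- spread to every node, including an end of edge `k`.
  let T : ReductionNode 𝒞 S → Prop := fun w =>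
    ∀ j : (Sᶜ : Finset (Fin n)), (j : Fin n) ∈ K → w.1 j = v.1 j
  have hstep : ∀ x y, (iteratedReduction 𝒞 S).Adj x y → T x → T y := by
    intro x y hxy hx j hj
    obtain ⟨-, i, hi, hxi, hyi⟩ := (adj_iff ha hS).1 hxy
    have hiK : i ∉ K := fun hiK => by
      obtain ⟨j, hj, hne⟩ := hcon x.1 i hiK hi hxi
      exact hne (hx j hj)
    have hji : (j : Fin n) ≠ i := fun h => hiK (h ▸ hj)
    rw [hyi j hji, ← hxi j hji, hx j hj]
  let u : ReductionNode 𝒞 S :=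
    ⟨edgeEnd a S k true, (isNode_iff ha hS).2 ⟨k, hkS, onEdge_edgeEnd k true⟩⟩
  have hTu : T v = T u := reachable_invariant
    (fun x y hxy => propext ⟨hstep x y hxy, hstep y x hxy.symm⟩) (hconn.preconnected v u)
  obtain ⟨j, hj, hne⟩ := hcon u.1 k hkK hkS (onEdge_edgeEnd k true)
  exact hne (hTu.mp (fun _ _ => rfl) j hj)

lemma mem_union_iff (ha : ∀ Q, Q ∈ 𝒞 ↔ ∃ I : Finset (Fin n), I.card = d ∧ Q = cube I (a I))
    {x : Fin n → Bool} :
    x ∈ union 𝒞 ↔ ∃ I : Finset (Fin n), I.card = d ∧ ∀ i, i ∉ I → x i = a I i := by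
  simp only [union, mem_biUnion, ha, id]
  constructor
  · rintro ⟨_, ⟨I, hI, rfl⟩, hx⟩
    exact ⟨I, hI, mem_cube.1 hx⟩
  · rintro ⟨I, hI, hx⟩
    exact ⟨_, ⟨I, hI, rfl⟩, mem_cube.2 hx⟩

/-- If the reductions are connected, the cubes with directions in a large enough set `K` have the
same projection onto `K` as the whole collection. -/
lemma exists_cube_within
    (ha : ∀ Q, Q ∈ 𝒞 ↔ ∃ I : Finset (Fin n), I.card = d ∧ Q = cube I (a I))
    (hconn : ∀ S : Finset (Fin n), S.card + 1 = d → (iteratedReduction 𝒞 S).Connected)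
    {K : Finset (Fin n)} (hK : d ≤ K.card) {J : Finset (Fin n)} (hJ : J.card = d)
    {x : Fin n → Bool} (hx : ∀ i, i ∉ J → x i = a J i) :
    ∃ I ⊆ K, I.card = d ∧ ∃ y : Fin n → Bool, (∀ i, i ∉ I → y i = a I i) ∧
      ∀ i ∈ K, y i = x i := by
  -- Each step trades a direction `j ∉ K` for some `i ∈ K`.
  induction hm : (J \ K).card using Nat.strong_induction_on generalizing J x with
  | _ m ih =>
    by_cases hJK : J ⊆ K
    · exact ⟨J, hJK, hJ, x, hx, fun _ _ => rfl⟩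
    obtain ⟨j, hjJ, hjK⟩ := not_subset.1 hJK
    let S := J.erase j
    have hins : insert j S = J := insert_erase hjJ
    have hjS : j ∉ S := notMem_erase j J
    have hS : S.card + 1 = d := by rw [← card_insert_of_notMem hjS, hins, hJ]
    obtain ⟨k, hkK, hkS⟩ : ∃ k ∈ K, k ∉ S :=
      exists_mem_notMem_of_card_lt_card (by omega)
    let v : ReductionNode 𝒞 S := ⟨fun i => x i, (isNode_iff ha hS).2
      ⟨j, hjS, fun i hi => by
        rw [hins]
        exact hx i fun hiJ => mem_compl.1 i.2 (mem_erase.2 ⟨hi, hiJ⟩)⟩⟩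
    obtain ⟨w, i, hiK, hiS, hwi, hwv⟩ :=
      exists_onEdge_of_connected ha hS (hconn S hS) hkK hkS v
    -- The coordinates in `S` are free in both cubes, so those of `x` can be kept.
    let y : Fin n → Bool := fun l => if hl : l ∈ Sᶜ then w ⟨l, hl⟩ else x l
    have hy : ∀ l, l ∉ insert i S → y l = a (insert i S) l := by
      intro l hl
      rw [mem_insert, not_or] at hl
      have hl' : l ∈ Sᶜ := mem_compl.2 hl.2
      simp only [y, dif_pos hl']
      exact hwi ⟨l, hl'⟩ hl.1
    have hyx : ∀ l ∈ K, y l = x l := by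
      intro l hl
      by_cases hl' : l ∈ Sᶜ
      · simp only [y, dif_pos hl']
        exact hwv ⟨l, hl'⟩ hl
      · simp only [y, dif_neg hl']
    have hlt : (insert i S \ K).card < m := by
      rw [← hm, insert_sdiff_of_mem _ hiK]
      refine card_lt_card ⟨sdiff_subset_sdiff (erase_subset j J) le_rfl, fun hsub => ?_⟩
      exact hjS (mem_sdiff.1 (hsub (mem_sdiff.2 ⟨hjJ, hjK⟩))).1
    obtain ⟨I, hIK, hI, z, hz, hzy⟩ :=
      ih _ hlt (by rw [card_insert_of_notMem hiS, hS]) hy rfl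
    exact ⟨I, hIK, hI, z, hz, fun l hl => (hzy l hl).trans (hyx l hl)⟩

lemma not_realizes_union_of_connected
    (ha : ∀ Q, Q ∈ 𝒞 ↔ ∃ I : Finset (Fin n), I.card = d ∧ Q = cube I (a I))
    (hconn : ∀ S : Finset (Fin n), S.card + 1 = d → (iteratedReduction 𝒞 S).Connected)
    {K : Finset (Fin n)} (hK : K.card = d + 1) : ¬ Realizes (union 𝒞) K := by
  intro h
  -- At each `i ∈ K` this pattern contradicts the only coordinate in `K` fixed by the cube along
  -- `K.erase i`.
  obtain ⟨x, hx, hxK⟩ := h fun i => !(a (K.erase i) i)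
  obtain ⟨J, hJ, hxJ⟩ := (mem_union_iff ha).1 hx
  obtain ⟨I, hIK, hI, y, hy, hyx⟩ := exists_cube_within ha hconn (K := K) (by omega) hJ hxJ
  obtain ⟨i, hiK, hiI⟩ : ∃ i ∈ K, i ∉ I := exists_mem_notMem_of_card_lt_card (by omega)
  have hIe : I = K.erase i := eq_of_subset_of_card_le
    (fun l hl => mem_erase.2 ⟨fun h => hiI (h ▸ hl), hIK hl⟩) (by
      rw [card_erase_of_mem hiK]; omega)
  have h1 := hy i hiI
  rw [hyx i hiK, hxK i hiK, hIe] at h1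
  simp at h1

/-! ### Counting nodes and edges of a reduction -/

/-- An acyclic graph with one edge fewer than nodes is a tree. -/
lemma isTree_of_isAcyclic_of_card_le {V : Type*} [Finite V] [Nonempty V] {G : SimpleGraph V}
    (hG : G.IsAcyclic) (h : Nat.card V ≤ Nat.card G.edgeSet + 1) : G.IsTree := by
  -- Extend the forest to a spanning tree of the complete graph; the edge count leaves nothing to
  -- add.
  obtain ⟨T, hGT, -, hT⟩ :=
    SimpleGraph.connected_top.exists_isTree_le_of_le_of_isAcyclic (le_top (a := G)) hG
  have hc := (SimpleGraph.isTree_iff_connected_and_card.1 hT).2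
  have hE : G.edgeSet = T.edgeSet := by
    refine Set.eq_of_subset_of_ncard_le (SimpleGraph.edgeSet_mono hGT) ?_ (Set.toFinite _)
    simp only [Set.ncard]
    change Nat.card T.edgeSet ≤ Nat.card G.edgeSet
    omega
  rwa [SimpleGraph.edgeSet_injective hE]

instance : Finite (ReductionNode 𝒞 S) := inferInstanceAs (Finite (Subtype _))

lemma card_le_card_edgeSet
    (ha : ∀ Q, Q ∈ 𝒞 ↔ ∃ I : Finset (Fin n), I.card = d ∧ Q = cube I (a I))
    (hS : S.card + 1 = d) : (Sᶜ).card ≤ Nat.card (iteratedReduction 𝒞 S).edgeSet := by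
  let e : (Sᶜ : Finset (Fin n)) → Bool → ReductionNode 𝒞 S := fun i b =>
    ⟨edgeEnd a S i b, (isNode_iff ha hS).2 ⟨i, mem_compl.1 i.2, onEdge_edgeEnd _ b⟩⟩
  have hval : ∀ i b, (e i b).1 i = b := fun i b => by simp [e, edgeEnd]
  have hne : ∀ i, e i true ≠ e i false := fun i h => by
    have h1 := congrArg (fun u : ReductionNode 𝒞 S => u.1 i) h
    simp only [hval] at h1
    cases h1
  have hadj : ∀ i, (iteratedReduction 𝒞 S).Adj (e i true) (e i false) := fun i =>
    (adj_iff ha hS).2 ⟨hne i, i, mem_compl.1 i.2, onEdge_edgeEnd _ _, onEdge_edgeEnd _ _⟩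
  have hsep : ∀ i j : (Sᶜ : Finset (Fin n)), j ≠ i →
      ∀ b, (e i b).1 j = a (insert (i : Fin n) S) j :=
    fun i j hij b => onEdge_edgeEnd _ b j fun h => hij (Subtype.ext h)
  have hinj : Function.Injective fun i : (Sᶜ : Finset (Fin n)) =>
      (⟨s(e i true, e i false), hadj i⟩ : (iteratedReduction 𝒞 S).edgeSet) := by
    intro i j hij
    by_contra hne'
    have h2 := Sym2.eq_iff.1 (congrArg Subtype.val hij)
    have hij' : (e j true).1 i = (e j false).1 i := by
      rw [hsep j i hne', hsep j i hne']
    rcases h2 with ⟨h, h'⟩ | ⟨h, h'⟩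
    · rw [← h, ← h', hval, hval] at hij'
      cases hij'
    · rw [← h, ← h', hval, hval] at hij'
      cases hij'
  have := Nat.card_le_card_of_injective _ hinj
  rwa [Nat.card_eq_fintype_card, Fintype.card_coe] at this

lemma card_node_le
    (ha : ∀ Q, Q ∈ 𝒞 ↔ ∃ I : Finset (Fin n), I.card = d ∧ Q = cube I (a I))
    (hS : S.card + 1 = d) (hvc : vcDim (union 𝒞) ≤ d) :
    Nat.card (ReductionNode 𝒞 S) ≤ (Sᶜ).card + 1 := by
  classical
  let N : Finset ((Sᶜ : Finset (Fin n)) → Bool) :=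
    univ.filter fun v => ∃ Q, IsEdgeCube 𝒞 S Q ∧ Incident S v Q
  have hN : Nat.card (ReductionNode 𝒞 S) = N.card :=
    Nat.subtype_card N fun v => by simp [N]
  have hdim : ∀ J, Realizes N J → J.card ≤ 1 := by
    intro J hJ
    -- The coordinates in `S` are free over each node, so they add `d - 1` to any set the nodes
    -- shatter.
    have hreal : Realizes (union 𝒞) (S ∪ J.map (Function.Embedding.subtype _)) := by
      intro t
      obtain ⟨v, hv, hvt⟩ := hJ fun i => t i
      obtain ⟨i, hi, hvi⟩ := (isNode_iff ha hS).1 (mem_filter.1 hv).2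
      let x : Fin n → Bool := fun l => if hl : l ∈ Sᶜ then v ⟨l, hl⟩ else t l
      refine ⟨x, (mem_union_iff ha).2 ⟨insert i S, by rw [card_insert_of_notMem hi, hS], ?_⟩, ?_⟩
      · intro l hl
        rw [mem_insert, not_or] at hl
        have hl' : l ∈ Sᶜ := mem_compl.2 hl.2
        simp only [x, dif_pos hl']
        exact hvi ⟨l, hl'⟩ hl.1
      · intro l hl
        by_cases hl' : l ∈ Sᶜ
        · simp only [x, dif_pos hl']
          rcases mem_union.1 hl with h | h
          · exact absurd h (mem_compl.1 hl')
          · obtain ⟨l', hlJ, rfl⟩ := mem_map.1 h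
            exact hvt l' hlJ
        · simp only [x, dif_neg hl']
    have hdisj : Disjoint S (J.map (Function.Embedding.subtype _)) := by
      rw [Finset.disjoint_right]
      intro l hl
      obtain ⟨l', -, rfl⟩ := mem_map.1 hl
      exact mem_compl.1 l'.2
    have := (le_vcDim hreal).trans hvc
    rw [card_union_of_disjoint hdisj, card_map] at this
    omega
  have := card_le_sum_choose hdim
  rw [Fintype.card_coe, sum_range_succ, sum_range_one, Nat.choose_zero_right,
    Nat.choose_one_right] at this
  omega

end Reduction

end ConceptClass

open ConceptClass in
theorem theorem3 (n d : ℕ) (hd : 1 ≤ d) (hdn : d ≤ n)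
    (𝒞 : Finset (Finset (Fin n → Bool))) (h𝒞 : ConceptClass.IsComplete d 𝒞) :
    (∀ S : Finset (Fin n), S.card = d - 1 →
      (ConceptClass.iteratedReduction 𝒞 S).IsAcyclic) ∧
    ((ConceptClass.vcDim (ConceptClass.union 𝒞) = d ∧
        ConceptClass.IsMaximum (ConceptClass.union 𝒞)) ↔
      ∀ S : Finset (Fin n), S.card = d - 1 →
        (ConceptClass.iteratedReduction 𝒞 S).IsTree) ∧
    ((ConceptClass.vcDim (ConceptClass.union 𝒞) = d ∧
        ConceptClass.IsMaximum (ConceptClass.union 𝒞)) ↔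
      ∀ S : Finset (Fin n), S.card = d - 1 →
        (ConceptClass.iteratedReduction 𝒞 S).Connected) := by
  obtain ⟨a, ha⟩ := h𝒞.exists_anchor
  have hsucc : ∀ S : Finset (Fin n), S.card = d - 1 → S.card + 1 = d := fun S hS => by omega
  have hac : ∀ S : Finset (Fin n), S.card = d - 1 → (iteratedReduction 𝒞 S).IsAcyclic :=
    fun S hS => iteratedReduction_isAcyclic ha (hsucc S hS)
  -- Only the VC dimension enters here; maximality then follows through connectedness.
  have htree : vcDim (union 𝒞) = d → ∀ S : Finset (Fin n), S.card = d - 1 →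
      (iteratedReduction 𝒞 S).IsTree := by
    intro hvc S hS
    obtain ⟨i, hi⟩ : ∃ i, i ∉ S := by
      by_contra! h
      have := congrArg Finset.card (Finset.eq_univ_iff_forall.2 h)
      rw [Finset.card_univ, Fintype.card_fin] at this
      omega
    have : Nonempty (ReductionNode 𝒞 S) := ⟨⟨edgeEnd a S i true,
      (isNode_iff ha (hsucc S hS)).2 ⟨i, hi, onEdge_edgeEnd i true⟩⟩⟩
    refine isTree_of_isAcyclic_of_card_le (hac S hS) ?_
    have h1 := card_node_le ha (hsucc S hS) hvc.le
    have h2 := card_le_card_edgeSet ha (hsucc S hS)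
    omega
  have hmax : (∀ S : Finset (Fin n), S.card = d - 1 → (iteratedReduction 𝒞 S).Connected) →
      vcDim (union 𝒞) = d ∧ IsMaximum (union 𝒞) := by
    intro hconn
    have hshat := not_realizes_of_succ fun K hK =>
      not_realizes_union_of_connected ha (fun S hS => hconn S (by omega)) hK
    have hsub : ∀ I : Finset (Fin n), I.card ≤ d →
        ∃ b : Fin n → Bool, ∀ x : Fin n → Bool, (∀ i, i ∉ I → x i = b i) → x ∈ union 𝒞 := by
      intro I hI
      obtain ⟨J, hIJ, -, hJ⟩ := Finset.exists_subsuperset_card_eq (Finset.subset_univ I) hI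
        (by simpa using hdn)
      exact ⟨a J, fun x hx => (mem_union_iff ha).2
        ⟨J, hJ, fun i hi => hx i fun h => hi (hIJ h)⟩⟩
    have hvc : vcDim (union 𝒞) = d := by
      refine le_antisymm (vcDim_le hshat) ?_
      obtain ⟨J, -, hJ⟩ := Finset.exists_subset_card_eq (s := (Finset.univ : Finset (Fin n)))
        (n := d) (by simpa using hdn)
      rw [← hJ]
      refine le_vcDim fun t => ?_
      obtain ⟨c, hc, hct⟩ := realizes_cube J (a J) t
      exact ⟨c, (mem_union_iff ha).2 ⟨J, hJ, mem_cube.1 hc⟩, hct⟩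
    refine ⟨hvc, ?_⟩
    rw [IsMaximum, hvc]
    have h1 := card_le_sum_choose hshat
    have h2 := sum_choose_le_card hsub
    rw [Fintype.card_fin] at h1 h2
    exact le_antisymm h1 h2
  exact ⟨hac, ⟨fun h => htree h.1, fun h => hmax fun S hS => (h S hS).connected⟩,
    ⟨fun h S hS => (htree h.1 S hS).connected, hmax⟩⟩
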